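/- Let $E$ be a complex Banach lattice, i.e. the complexification of a real Banach lattice $E_{\mathbb R}$, with norm $\|x+iy\| = \big\|\sup_{\theta\in\mathbb R}(\cos\theta\, x+\sin\theta\, y)\big\|$ for $x,y\in E_{\mathbb R}$. Let $E_+ = (E_{\mathbb R})_+$ be its positive cone and let $E'_+$ be the set of all bounded linear functionals $x'$ on $E$ with $\langle x',x\rangle\in[0,\infty)$ for every $x\in E_+$. Let $T$ be a bounded linear operator on $E$ with spectral radius $r(T)>0$ and put $S := T/r(T)$. For $z\in\mathbb C$ let $d_+(z)$ denote the distance of $z$ to $[0,\infty)$ in $\mathbb C$. Let $c_0$ be the space of complex sequences $(a_n)_{n\ge 0}$ converging to $0$ and let $(c_0)_+$ be the set of those with entries in $[0,\infty)$. For $a\in(c_0)_+$ let $a^*=(a^*_n)_{n\ge 0}$ be its decreasing rearrangement, $a^*_n=\min\{t\ge 0 : \#\{k : a_k>t\}\le n\}$. A set $F\subseteq (c_0)_+$ is said to govern a sequence $a=(a_n)_{n\ge 0}$ of complex numbers if $a\in c_0$ and there are $f\in F$ and a constant $c\ge 0$ such that $(|a|^*)_n\le c f_n$ for all $n\ge 0$.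 (i) Let $f\in(c_0)_+$ and suppose that for all $x\in E_+$ and $x'\in E'_+$ the set $\{f\}$ governs the sequence $\big(d_+(\langle x',S^n x\rangle)\big)_{n\ge 0}$. Then $r(T)\in\sigma(T)$. (ii) More generally, let $F\subseteq(c_0)_+$ be an at most countable set and suppose that for all $x\in E_+$ and $x'\in E'_+$ the set $F$ governs the sequence $\big(d_+(\langle x',S^n x\rangle)\big)_{n\ge 0}$. Then $r(T)\in\sigma(T)$. -/

import Mathlib

open Filter Topology

noncomputable section

/-- The complex Banach space `E` is (a copy of) the complexification of the real Banach lattice `X`,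
that is, `E` is a complex Banach lattice with underlying real Banach lattice `E_ℝ = ofReal '' X`:
every `z : E` is uniquely of the form `x + i y` with `x y : X`, the modulus
`|x + i y| = sup_θ (cos θ • x + sin θ • y)` exists in `X` (it does so in every real Banach lattice),
and the norm of `E` is `‖x + i y‖ = ‖ |x + i y| ‖`. -/
structure ComplexBanachLattice (X E : Type*)
    [NormedAddCommGroup X] [NormedSpace ℝ X] [CompleteSpace X]
    [Lattice X] [IsOrderedAddMonoid X] [IsOrderedModule ℝ X] [HasSolidNorm X]
    [NormedAddCommGroup E] [NormedSpace ℂ E] [CompleteSpace E] where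
  /-- the inclusion of the real part -/
  ofReal : X →ₗ[ℝ] E
  existsUnique_re_im : ∀ z : E, ∃! p : X × X, z = ofReal p.1 + Complex.I • ofReal p.2
  exists_modulus : ∀ x y : X, ∃ m : X,
    IsLUB (Set.range fun θ : ℝ => Real.cos θ • x + Real.sin θ • y) m ∧
      ‖ofReal x + Complex.I • ofReal y‖ = ‖m‖

namespace ComplexBanachLattice

variable {X E : Type*}
    [NormedAddCommGroup X] [NormedSpace ℝ X] [CompleteSpace X]
    [Lattice X] [IsOrderedAddMonoid X] [IsOrderedModule ℝ X] [HasSolidNorm X]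
    [NormedAddCommGroup E] [NormedSpace ℂ E] [CompleteSpace E]

/-- The positive cone `E_+`. -/
def posCone (L : ComplexBanachLattice X E) : Set E := L.ofReal '' Set.Ici 0

/-- The cone `E'_+` of positive functionals in the norm dual `E'`. -/
def dualPosCone (L : ComplexBanachLattice X E) : Set (StrongDual ℂ E) :=
  {φ | ∀ x ∈ L.posCone, ∃ t : ℝ, 0 ≤ t ∧ φ x = (t : ℂ)}

end ComplexBanachLattice

/-- `d_+(z)`: the distance of a complex number to the positive cone `[0, ∞)` of `ℂ`. -/
def distPos (z : ℂ) : ℝ := Metric.infDist z ((fun t : ℝ => (t : ℂ)) '' Set.Ici 0)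

/-- The spectral radius as a real number (it is finite for bounded operators on Banach spaces). -/
def specRad {E : Type*} [NormedAddCommGroup E] [NormedSpace ℂ E] (T : E →L[ℂ] E) : ℝ :=
  (spectralRadius ℂ T).toReal

/-- The positive cone of `c₀`: nonnegative real sequences that converge to `0`. -/
def c0Pos : Set (ℕ → ℝ) := {f | (∀ n, 0 ≤ f n) ∧ Tendsto f atTop (𝓝 0)}

/-- The decreasing rearrangement of a nonnegative null sequence: the `n`-th entry is the least
`t ≥ 0` such that at most `n` entries of `x` (counted by their indices) exceed `t`. -/
def decreasingRearrangement (x : ℕ → ℝ) (n : ℕ) : ℝ :=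
  sInf {t : ℝ | 0 ≤ t ∧ {k : ℕ | t < x k}.encard ≤ n}

/-- The nonnegative elements of the principal ideal `(c₀)_f`, for `f` in the positive cone
of `c₀`. -/
def principalIdealPos (f : ℕ → ℝ) : Set (ℕ → ℝ) :=
  {y | y ∈ c0Pos ∧ ∃ c : ℝ, 0 ≤ c ∧ ∀ n, y n ≤ c * f n}

/-- A set `F` of sequences in the positive cone of `c₀` governs the complex sequence `a` if `a` is
a null sequence and the decreasing rearrangement of `|a|` belongs to the principal ideal `(c₀)_f`
for some `f ∈ F`. -/
def Governs (F : Set (ℕ → ℝ)) (a : ℕ → ℂ) : Prop :=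
  Tendsto a atTop (𝓝 0) ∧
    ∃ f ∈ F, decreasingRearrangement (fun n => ‖a n‖) ∈ principalIdealPos f

end

/-! Suppose `r(T)` is not in the spectrum and choose `ζ` in it with `|ζ| = r(T)`. For `w = r(T)/ζ`,
`1 - S` is invertible but `1 - w S` is not. With `U(z) = (1 - z S)⁻¹` and `s ↑ 1`, two estimates
collide. Expanding `φ(U(s w) x)` in powers and using `|a| ≤ Re a + 2 d₊(a)` bounds it by `|φ(U(s)
x)|`, which stays bounded, plus twice the Abel sum of `d₊(φ(Sⁿ x))`. The rearrangement bound makes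
that Abel sum, times `1 - s`, at most a multiple of a null sequence `h` independent of `x` and `φ`.
Positive vectors and functionals span, so uniform boundedness gives `(1 - s) ‖U(s w)‖ ≤ C h → 0`.
But the resolvent norm grows at least like `1/(1 - s)` near the singular point `w`. The common rate
is what lets weak decay pass to operator norms; a countable `F` reduces to one sequence. -/

/-! ### Positive functionals on a real normed lattice. -/

section RealLattice

variable {X : Type*} [NormedAddCommGroup X] [NormedSpace ℝ X]
    [Lattice X] [IsOrderedAddMonoid X] [IsOrderedModule ℝ X] [HasSolidNorm X]

/-- The dual cone of a normed lattice is majorizing: every bounded functional is dominated on the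
positive cone by a positive one. -/
theorem StrongDual.exists_nonneg_majorant (g : StrongDual ℝ X) :
    ∃ ψ : StrongDual ℝ X, (∀ x, 0 ≤ x → 0 ≤ ψ x) ∧ ∀ x, 0 ≤ x → g x ≤ ψ x := by
  let Q := {q : X × X // 0 ≤ q.1 ∧ 0 ≤ q.2}
  let G : X → Q → ℝ := fun x q => ‖g‖ * ‖x + q.1.1 + q.1.2‖ - g q.1.1
  -- Any linear `ψ ≤ p` works: testing at `-x`, the pair `(0, x)` gives `0 ≤ ψ x` and `(x, 0)` gives
  -- `g x ≤ ψ x`. Finiteness of `p` comes from `‖u‖ ≤ ‖u + v‖` for `u, v ≥ 0`.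
  let p : X → ℝ := fun x => ⨅ q, G x q
  have hQ : Nonempty Q := ⟨⟨(0, 0), le_rfl, le_rfl⟩⟩
  have hlow (x : X) (q : Q) : -(‖g‖ * ‖x‖) ≤ G x q := by
    obtain ⟨⟨u, v⟩, hu, hv⟩ := q
    have h1 : ‖u‖ ≤ ‖u + v‖ := by
      apply norm_le_norm_of_abs_le_abs
      rw [abs_of_nonneg hu, abs_of_nonneg (add_nonneg hu hv)]
      exact le_add_of_nonneg_right hv
    have h2 : ‖u + v‖ ≤ ‖x + u + v‖ + ‖x‖ := by
      calc ‖u + v‖ = ‖(x + u + v) - x‖ := by congr 1; abel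
        _ ≤ _ := norm_sub_le _ _
    have h3 : g u ≤ ‖g‖ * ‖u‖ := (le_abs_self _).trans (g.le_opNorm u)
    have h4 := mul_le_mul_of_nonneg_left (h1.trans h2) (norm_nonneg g)
    change -(‖g‖ * ‖x‖) ≤ ‖g‖ * ‖x + u + v‖ - g u
    linarith
  have hbdd (x : X) : BddBelow (Set.range (G x)) :=
    ⟨-(‖g‖ * ‖x‖), by rintro _ ⟨q, rfl⟩; exact hlow x q⟩
  have hle (x : X) (q : Q) : p x ≤ G x q := ciInf_le (hbdd x) q
  have hadd (x y : X) : p (x + y) ≤ p x + p y := by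
    refine le_ciInf_add_ciInf fun q q' => ?_
    refine (hle (x + y) ⟨q.1 + q'.1, add_nonneg q.2.1 q'.2.1, add_nonneg q.2.2 q'.2.2⟩).trans ?_
    have h1 : ‖x + y + (q.1.1 + q'.1.1) + (q.1.2 + q'.1.2)‖
        ≤ ‖x + q.1.1 + q.1.2‖ + ‖y + q'.1.1 + q'.1.2‖ := by
      refine le_trans (le_of_eq ?_) (norm_add_le _ _)
      congr 1; abel
    have h2 := mul_le_mul_of_nonneg_left h1 (norm_nonneg g)
    simp only [G, Prod.fst_add, Prod.snd_add, map_add]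
    linarith
  have hsmul_le (c : ℝ) (hc : 0 < c) (x : X) : p (c • x) ≤ c * p x := by
    rw [← div_le_iff₀' hc]
    refine le_ciInf fun q => ?_
    rw [div_le_iff₀' hc]
    refine (hle (c • x) ⟨c • q.1, smul_nonneg hc.le q.2.1, smul_nonneg hc.le q.2.2⟩).trans ?_
    simp only [G, Prod.smul_fst, Prod.smul_snd, map_smul, ← smul_add, norm_smul, smul_eq_mul,
      Real.norm_of_nonneg hc.le]
    exact le_of_eq (by ring)
  have hsmul (c : ℝ) (hc : 0 < c) (x : X) : p (c • x) = c * p x := by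
    refine le_antisymm (hsmul_le c hc x) ?_
    have h := hsmul_le c⁻¹ (inv_pos.2 hc) (c • x)
    rwa [inv_smul_smul₀ hc.ne', le_inv_mul_iff₀ hc] at h
  have hzero (x : X) (hx : x ∈ (⊥ : Submodule ℝ X)) : (0 : ℝ) ≤ p x := by
    rw [Submodule.mem_bot] at hx
    subst hx
    exact le_ciInf fun q => by simpa using hlow 0 q
  obtain ⟨ψ, -, hψ⟩ := exists_extension_of_le_sublinear (⟨⊥, 0⟩ : X →ₗ.[ℝ] ℝ) p hsmul hadd
    (fun x => hzero x x.2)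
  have hup (x : X) : ψ x ≤ ‖g‖ * ‖x‖ :=
    (hψ x).trans ((hle x ⟨(0, 0), le_rfl, le_rfl⟩).trans (by simp [G]))
  refine ⟨ψ.mkContinuous ‖g‖ fun x => abs_le.2 ⟨?_, hup x⟩, fun x hx => ?_, fun x hx => ?_⟩
  · have := hup (-x)
    rw [map_neg, norm_neg] at this
    linarith
  · have := (hψ (-x)).trans (hle (-x) ⟨(0, x), le_rfl, hx⟩)
    simp only [map_neg, G, add_zero, neg_add_cancel, norm_zero, mul_zero, map_zero] at this
    simpa using this
  · have := (hψ (-x)).trans (hle (-x) ⟨(x, 0), hx, le_rfl⟩)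
    simp only [map_neg, G, add_zero, neg_add_cancel, norm_zero, mul_zero] at this
    simp only [LinearMap.mkContinuous_apply]
    linarith

/-- Every bounded functional on a normed lattice is a difference of positive ones. -/
theorem StrongDual.exists_eq_sub_nonneg (g : StrongDual ℝ X) :
    ∃ ψ χ : StrongDual ℝ X, (∀ x, 0 ≤ x → 0 ≤ ψ x) ∧ (∀ x, 0 ≤ x → 0 ≤ χ x) ∧ g = ψ - χ := by
  obtain ⟨ψ, h0, h1⟩ := g.exists_nonneg_majorant
  exact ⟨ψ, ψ - g, h0, fun x hx => by simpa using h1 x hx, by simp⟩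

end RealLattice

/-! ### Real parts, and spanning by the positive cones. -/

namespace ComplexBanachLattice

variable {X E : Type*}
    [NormedAddCommGroup X] [NormedSpace ℝ X] [CompleteSpace X]
    [Lattice X] [IsOrderedAddMonoid X] [IsOrderedModule ℝ X] [HasSolidNorm X]
    [NormedAddCommGroup E] [NormedSpace ℂ E] [CompleteSpace E]
    (L : ComplexBanachLattice X E)

theorem norm_le_norm_add_I_smul (x y : X) :
    ‖x‖ ≤ ‖L.ofReal x + Complex.I • L.ofReal y‖ := by
  obtain ⟨m, hm, hn⟩ := L.exists_modulus x y
  rw [hn]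
  have h1 : x ≤ m := hm.1 ⟨0, by simp⟩
  have h2 : -x ≤ m := hm.1 ⟨Real.pi, by simp⟩
  exact norm_le_norm_of_abs_le_abs ((abs_le'.2 ⟨h1, h2⟩).trans (le_abs_self m))

theorem norm_ofReal_le (x : X) : ‖L.ofReal x‖ ≤ ‖x‖ := by
  obtain ⟨m, hm, hn⟩ := L.exists_modulus x 0
  rw [map_zero, smul_zero, add_zero] at hn
  rw [hn]
  have h1 : m ≤ |x| := hm.2 <| by
    rintro _ ⟨θ, rfl⟩
    simp only [smul_zero, add_zero]
    have h0 (c : ℝ) (hc : 0 ≤ c) (hc' : c ≤ 1) (y : X) (hy : y ≤ |x|) : c • y ≤ |x| :=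
      (smul_le_smul_of_nonneg_left hy hc).trans
        ((smul_le_smul_of_nonneg_right hc' (abs_nonneg x)).trans_eq (one_smul ℝ _))
    rcases le_total 0 (Real.cos θ) with h | h
    · exact h0 _ h (Real.cos_le_one θ) x (le_abs_self x)
    · rw [← neg_smul_neg]
      exact h0 _ (neg_nonneg.2 h) (by linarith [Real.neg_one_le_cos θ]) (-x) (neg_le_abs x)
  have h2 : |x| ≤ m := abs_le'.2 ⟨hm.1 ⟨0, by simp⟩, hm.1 ⟨Real.pi, by simp⟩⟩
  rw [le_antisymm h1 h2, norm_abs_eq_norm]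

theorem ofReal_pair_injective {p q : X × X}
    (h : L.ofReal p.1 + Complex.I • L.ofReal p.2 = L.ofReal q.1 + Complex.I • L.ofReal q.2) :
    p = q :=
  (L.existsUnique_re_im _).unique rfl h

/-- The real part of an element of a complex Banach lattice. -/
noncomputable def re : E →L[ℝ] X :=
  LinearMap.mkContinuous
    { toFun := fun z => (L.existsUnique_re_im z).choose.1
      map_add' := fun z w => by
        rw [← Prod.fst_add]
        congr 1
        apply L.ofReal_pair_injective
        rw [← (L.existsUnique_re_im (z + w)).choose_spec.1]
        conv_lhs => rw [(L.existsUnique_re_im z).choose_spec.1,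
          (L.existsUnique_re_im w).choose_spec.1]
        simp only [Prod.fst_add, Prod.snd_add, map_add, smul_add]
        abel
      map_smul' := fun c z => by
        rw [RingHom.id_apply, ← Prod.smul_fst]
        congr 1
        apply L.ofReal_pair_injective
        rw [← (L.existsUnique_re_im (c • z)).choose_spec.1]
        conv_lhs => rw [(L.existsUnique_re_im z).choose_spec.1]
        simp only [Prod.smul_fst, Prod.smul_snd, map_smul, smul_add, smul_comm c Complex.I] }
    1 fun z => by
      rw [one_mul]
      conv_rhs => rw [(L.existsUnique_re_im z).choose_spec.1]
      exact L.norm_le_norm_add_I_smul _ _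

theorem re_add_I_smul (x y : X) : L.re (L.ofReal x + Complex.I • L.ofReal y) = x := by
  have := L.ofReal_pair_injective (q := (x, y))
    (L.existsUnique_re_im (L.ofReal x + Complex.I • L.ofReal y)).choose_spec.1.symm
  exact congrArg Prod.fst this

theorem re_ofReal (x : X) : L.re (L.ofReal x) = x := by
  simpa using L.re_add_I_smul x 0

theorem re_I_smul_ofReal (x : X) : L.re (Complex.I • L.ofReal x) = 0 := by
  simpa using L.re_add_I_smul 0 x

/-- The inclusion of the real part as a bounded operator. -/
noncomputable def ofRealCLM : X →L[ℝ] E :=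
  L.ofReal.mkContinuous 1 fun x => by simpa using L.norm_ofReal_le x

/-- The complex linear extension of a bounded functional on the real part. -/
noncomputable def extendDual (ψ : StrongDual ℝ X) : StrongDual ℂ E :=
  StrongDual.extendRCLike (ψ.comp L.re)

theorem extendDual_ofReal (ψ : StrongDual ℝ X) (x : X) :
    L.extendDual ψ (L.ofReal x) = (ψ x : ℂ) := by
  simp [extendDual, StrongDual.extendRCLike_apply, re_ofReal, re_I_smul_ofReal]

theorem extendDual_mem_dualPosCone {ψ : StrongDual ℝ X} (hψ : ∀ x, 0 ≤ x → 0 ≤ ψ x) :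
    L.extendDual ψ ∈ L.dualPosCone := by
  rintro _ ⟨x, hx, rfl⟩
  exact ⟨ψ x, hψ x hx, L.extendDual_ofReal ψ x⟩

theorem dual_ext {φ χ : StrongDual ℂ E} (h : ∀ x, φ (L.ofReal x) = χ (L.ofReal x)) : φ = χ := by
  ext z
  obtain ⟨p, rfl, -⟩ := L.existsUnique_re_im z
  simp [h]

/-- The positive cone spans the space. -/
theorem span_posCone : Submodule.span ℂ L.posCone = ⊤ := by
  have h (x : X) : L.ofReal x ∈ Submodule.span ℂ L.posCone := by
    rw [← posPart_sub_negPart x, map_sub]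
    exact sub_mem (Submodule.subset_span ⟨_, posPart_nonneg x, rfl⟩)
      (Submodule.subset_span ⟨_, negPart_nonneg x, rfl⟩)
  refine eq_top_iff.2 fun z _ => ?_
  obtain ⟨p, rfl, -⟩ := L.existsUnique_re_im z
  exact add_mem (h _) (Submodule.smul_mem _ _ (h _))

/-- The positive functionals span the dual space. -/
theorem span_dualPosCone : Submodule.span ℂ L.dualPosCone = ⊤ := by
  have h (g : StrongDual ℝ X) : L.extendDual g ∈ Submodule.span ℂ L.dualPosCone := by
    obtain ⟨ψ, χ, hψ, hχ, rfl⟩ := g.exists_eq_sub_nonneg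
    have : L.extendDual (ψ - χ) = L.extendDual ψ - L.extendDual χ :=
      L.dual_ext fun x => by simp [extendDual_ofReal]
    rw [this]
    exact sub_mem (Submodule.subset_span (L.extendDual_mem_dualPosCone hψ))
      (Submodule.subset_span (L.extendDual_mem_dualPosCone hχ))
  refine eq_top_iff.2 fun φ _ => ?_
  let A : X →L[ℝ] ℂ := (φ.restrictScalars ℝ).comp L.ofRealCLM
  have : φ = L.extendDual (Complex.reCLM.comp A) +
      Complex.I • L.extendDual (Complex.imCLM.comp A) := by
    refine L.dual_ext fun x => ?_
    have hA : A x = φ (L.ofReal x) := rfl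
    simp only [add_apply, smul_apply, extendDual_ofReal,
      ContinuousLinearMap.comp_apply, hA, Complex.reCLM_apply, Complex.imCLM_apply, smul_eq_mul]
    rw [mul_comm]
    exact (Complex.re_add_im _).symm
  rw [this]
  exact add_mem (h _) (Submodule.smul_mem _ _ (h _))

end ComplexBanachLattice

/-! ### Resolvent series and resolvent growth. -/

/-- The resolvent is holomorphic on the open unit disc, so its Taylor series, known near `0`,
converges to it there even when `‖z • a‖ ≥ 1`. -/
theorem hasSum_inverse_one_sub_smul {A : Type*} [NormedRing A] [NormedAlgebra ℂ A]
    [CompleteSpace A] {a : A} (ha : spectralRadius ℂ a ≤ 1) {z : ℂ} (hz : ‖z‖ < 1) :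
    HasSum (fun n : ℕ => z ^ n • a ^ n) (Ring.inverse (1 - z • a)) := by
  obtain ⟨r, hzr, hr⟩ := exists_between hz
  lift r to NNReal using (norm_nonneg z).trans hzr.le
  have hr0 : 0 < r := by exact_mod_cast (norm_nonneg z).trans_lt hzr
  have hr1 : (r : ENNReal) < (spectralRadius ℂ a)⁻¹ :=
    lt_of_lt_of_le (by exact_mod_cast hr) (ENNReal.one_le_inv.2 ha)
  have h := (spectrum.hasFPowerSeriesOnBall_inverse_one_sub_smul ℂ a).exchange_radius
    ((spectrum.differentiableOn_inverse_one_sub_smul hr1).hasFPowerSeriesOnBall hr0)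
  have := h.hasSum (y := z) (by
    rw [Metric.mem_eball, edist_zero_right, ← ofReal_norm,
      ENNReal.ofReal_lt_coe_iff (norm_nonneg z)]
    exact hzr)
  simpa using this

/-- Otherwise a Neumann series perturbation of `1 - z • a` would invert `1 - w • a`. -/
theorem one_le_norm_sub_mul_norm_inverse {A : Type*} [NormedRing A] [NormedAlgebra ℂ A]
    [CompleteSpace A] {a : A} {z w : ℂ} (hz : IsUnit (1 - z • a)) (hw : ¬ IsUnit (1 - w • a)) :
    1 ≤ ‖w - z‖ * ‖Ring.inverse (1 - z • a)‖ * ‖a‖ := by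
  by_contra! h
  refine hw ?_
  have h1 : 1 - w • a = (1 - z • a) * (1 - (w - z) • (Ring.inverse (1 - z • a) * a)) := by
    rw [mul_sub, mul_one, mul_smul_comm, ← mul_assoc, Ring.mul_inverse_cancel _ hz, one_mul,
      sub_smul]
    abel
  rw [h1]
  refine hz.mul (isUnit_one_sub_of_norm_lt_one (lt_of_le_of_lt ?_ h))
  rw [norm_smul, mul_assoc]
  exact mul_le_mul_of_nonneg_left (norm_mul_le _ _) (norm_nonneg _)

/-! ### Distance to the half line, rearrangements and Abel means. -/

theorem distPos_nonneg (z : ℂ) : 0 ≤ distPos z := Metric.infDist_nonneg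

/-- Trades absolute values for real parts, which sum back to a resolvent. For `t ≥ 0`, both `|z| -
t` and `t - Re z` are at most `|z - t|`. -/
theorem norm_le_re_add_two_mul_distPos (z : ℂ) : ‖z‖ ≤ z.re + 2 * distPos z := by
  have h : (‖z‖ - z.re) / 2 ≤ distPos z := by
    refine (Metric.le_infDist ((Set.nonempty_Ici (a := (0 : ℝ))).image _)).2 ?_
    rintro _ ⟨t, ht, rfl⟩
    simp only
    rw [dist_eq_norm]
    have h1 : ‖z‖ ≤ ‖z - t‖ + ‖(t : ℂ)‖ := by simpa using norm_add_le (z - t) (t : ℂ)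
    have h2 := (abs_le.1 (Complex.abs_re_le_norm (z - t))).1
    rw [Complex.norm_real, Real.norm_of_nonneg ht] at h1
    simp only [Complex.sub_re, Complex.ofReal_re] at h2
    linarith
  linarith

theorem encard_lt_of_decreasingRearrangement_lt {d : ℕ → ℝ} (hd : BddAbove (Set.range d)) {m : ℕ}
    {t : ℝ} (h : decreasingRearrangement d m < t) : {k : ℕ | t < d k}.encard ≤ m := by
  obtain ⟨B, hB⟩ := hd
  have hne : {t : ℝ | 0 ≤ t ∧ {k : ℕ | t < d k}.encard ≤ m}.Nonempty := by
    refine ⟨max B 0, le_max_right _ _, ?_⟩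
    have : {k : ℕ | max B 0 < d k} = ∅ :=
      Set.eq_empty_of_forall_notMem fun k hk =>
        absurd (hB ⟨k, rfl⟩) (not_le.2 ((le_max_left _ _).trans_lt hk))
    rw [this, Set.encard_empty]
    exact zero_le
  obtain ⟨u, ⟨-, hu⟩, hut⟩ := exists_lt_of_csInf_lt hne h
  exact (Set.encard_le_encard fun k (hk : t < d k) => hut.trans hk).trans hu

/-- The Abel means of a bounded nonnegative sequence with few entries above a level `t`. -/
theorem one_sub_mul_tsum_pow_mul_le {d : ℕ → ℝ} (hd : ∀ n, 0 ≤ d n) {B t s : ℝ}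
    (hB : ∀ n, d n ≤ B) (ht : 0 ≤ t) {m : ℕ} (hm : {k : ℕ | t < d k}.encard ≤ m)
    (hs : 0 ≤ s) (hs1 : s < 1) :
    Summable (fun n => s ^ n * d n) ∧ (1 - s) * ∑' n, s ^ n * d n ≤ t + (1 - s) * (m * B) := by
  have hgeom := hasSum_geometric_of_lt_one hs hs1
  have hsum : Summable (fun n => s ^ n * d n) :=
    Summable.of_nonneg_of_le (fun n => mul_nonneg (pow_nonneg hs n) (hd n))
      (fun n => mul_le_mul_of_nonneg_left (hB n) (pow_nonneg hs n)) (hgeom.summable.mul_right B)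
  refine ⟨hsum, ?_⟩
  have hfin : {k : ℕ | t < d k}.Finite :=
    Set.finite_of_encard_le_coe hm
  have hcard : (hfin.toFinset.card : ℝ) ≤ m := by
    rw [hfin.encard_eq_coe_toFinset_card] at hm
    exact_mod_cast hm
  have hB0 : 0 ≤ B := (hd 0).trans (hB 0)
  have hK : HasSum (fun n => if n ∈ hfin.toFinset then B else 0) (hfin.toFinset.card * B) := by
    have h : HasSum (fun n => if n ∈ hfin.toFinset then B else 0)
        (∑ n ∈ hfin.toFinset, if n ∈ hfin.toFinset then B else 0) :=
      hasSum_sum_of_ne_finset_zero fun n hn => if_neg hn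
    rwa [Finset.sum_congr rfl fun n hn => if_pos hn, Finset.sum_const, nsmul_eq_mul] at h
  -- Entries up to `t` are summed geometrically; each exceptional one costs at most `B`, wherever it
  -- occurs.
  have hle : ∑' n, s ^ n * d n ≤ (1 - s)⁻¹ * t + hfin.toFinset.card * B := by
    refine hasSum_le (fun n => ?_) hsum.hasSum ((hgeom.mul_right t).add hK)
    by_cases hn : t < d n
    · rw [if_pos (by simpa using hn)]
      have h1 : s ^ n * d n ≤ 1 * d n :=
        mul_le_mul_of_nonneg_right (pow_le_one₀ hs hs1.le) (hd n)
      linarith [hB n, mul_nonneg (pow_nonneg hs n) ht]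
    · rw [if_neg (by simpa using hn), add_zero]
      exact mul_le_mul_of_nonneg_left (not_lt.1 hn) (pow_nonneg hs n)
  have h1s : 0 < 1 - s := sub_pos.2 hs1
  calc (1 - s) * ∑' n, s ^ n * d n
      ≤ (1 - s) * ((1 - s)⁻¹ * t + hfin.toFinset.card * B) :=
        mul_le_mul_of_nonneg_left hle h1s.le
    _ = t + (1 - s) * (hfin.toFinset.card * B) := by field_simp
    _ ≤ _ := by gcongr

/-! ### From weak estimates to operator norms. -/

section Operator

variable {E : Type*} [NormedAddCommGroup E] [NormedSpace ℂ E] [CompleteSpace E]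

theorem norm_apply_inverse_one_sub_smul_le {S : E →L[ℂ] E} (hS : spectralRadius ℂ S ≤ 1)
    (φ : StrongDual ℂ E) (x : E) {s : ℝ} (hs : 0 ≤ s) (hs1 : s < 1) {w : ℂ} (hw : ‖w‖ = 1)
    (hd : Summable fun n : ℕ => s ^ n * distPos (φ ((S ^ n) x))) :
    ‖φ (Ring.inverse (1 - ((s : ℂ) * w) • S) x)‖ ≤
      ‖φ (Ring.inverse (1 - (s : ℂ) • S) x)‖ + 2 * ∑' n : ℕ, s ^ n * distPos (φ ((S ^ n) x)) := by
  have key (z : ℂ) (hz : ‖z‖ < 1) : HasSum (fun n : ℕ => z ^ n * φ ((S ^ n) x))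
      (φ (Ring.inverse (1 - z • S) x)) := by
    simpa using (hasSum_inverse_one_sub_smul hS hz).mapL
      (φ.comp (ContinuousLinearMap.apply ℂ E x))
  have hns : ‖(s : ℂ)‖ = s := by rw [Complex.norm_real, Real.norm_of_nonneg hs]
  have h1 := key s (hns.trans_lt hs1)
  have h2 := key (s * w) (by rw [norm_mul, hns, hw, mul_one]; exact hs1)
  have hn : Summable fun n : ℕ => s ^ n * ‖φ ((S ^ n) x)‖ := by
    simpa only [norm_mul, norm_pow, hns] using h1.summable.norm
  have hre : HasSum (fun n : ℕ => s ^ n * (φ ((S ^ n) x)).re)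
      (φ (Ring.inverse (1 - (s : ℂ) • S) x)).re := by
    simpa only [← Complex.ofReal_pow, Complex.re_ofReal_mul] using Complex.hasSum_re h1
  calc ‖φ (Ring.inverse (1 - ((s : ℂ) * w) • S) x)‖
      ≤ ∑' n : ℕ, s ^ n * ‖φ ((S ^ n) x)‖ := by
        rw [← h2.tsum_eq]
        refine tsum_of_norm_bounded hn.hasSum fun n => ?_
        rw [norm_mul, norm_pow, norm_mul, hns, hw, mul_one]
    _ ≤ (φ (Ring.inverse (1 - (s : ℂ) • S) x)).re +
          2 * ∑' n : ℕ, s ^ n * distPos (φ ((S ^ n) x)) := by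
        refine hasSum_le (fun n => ?_) hn.hasSum (hre.add (hd.hasSum.mul_left 2))
        have := mul_le_mul_of_nonneg_left (norm_le_re_add_two_mul_distPos (φ ((S ^ n) x)))
          (pow_nonneg hs n)
        linarith
    _ ≤ _ := by gcongr; exact Complex.re_le_norm _

/-- A sequence of operators that is weakly bounded on spanning sets is bounded. -/
theorem exists_norm_le_of_weakly_bounded {P : Set E} {Q : Set (StrongDual ℂ E)}
    (hP : Submodule.span ℂ P = ⊤) (hQ : Submodule.span ℂ Q = ⊤) {A : ℕ → E →L[ℂ] E}
    (h : ∀ x ∈ P, ∀ φ ∈ Q, ∃ C, ∀ k, ‖φ (A k x)‖ ≤ C) : ∃ C, ∀ k, ‖A k‖ ≤ C := by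
  have hx (φ) (hφ : φ ∈ Q) (x : E) : ∃ C, ∀ k, ‖φ (A k x)‖ ≤ C := by
    have hx : x ∈ Submodule.span ℂ P := hP ▸ Submodule.mem_top
    induction hx using Submodule.span_induction with
    | mem x hx => exact h x hx φ hφ
    | zero => exact ⟨0, by simp⟩
    | add x y _ _ hx hy =>
      obtain ⟨C, hC⟩ := hx
      obtain ⟨D, hD⟩ := hy
      exact ⟨C + D, fun k => by
        rw [map_add, map_add]; exact (norm_add_le _ _).trans (add_le_add (hC k) (hD k))⟩
    | smul c x _ hx =>
      obtain ⟨C, hC⟩ := hx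
      exact ⟨‖c‖ * C, fun k => by
        rw [map_smul, map_smul, norm_smul]
        exact mul_le_mul_of_nonneg_left (hC k) (norm_nonneg c)⟩
  have hφ (x : E) (φ : StrongDual ℂ E) : ∃ C, ∀ k, ‖φ (A k x)‖ ≤ C := by
    have hφ : φ ∈ Submodule.span ℂ Q := hQ ▸ Submodule.mem_top
    induction hφ using Submodule.span_induction with
    | mem φ hφ => exact hx φ hφ x
    | zero => exact ⟨0, by simp⟩
    | add φ χ _ _ h1 h2 =>
      obtain ⟨C, hC⟩ := h1
      obtain ⟨D, hD⟩ := h2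
      exact ⟨C + D, fun k => (norm_add_le _ _).trans (add_le_add (hC k) (hD k))⟩
    | smul c φ _ h1 =>
      obtain ⟨C, hC⟩ := h1
      exact ⟨‖c‖ * C, fun k => by
        rw [smul_apply, norm_smul]
        exact mul_le_mul_of_nonneg_left (hC k) (norm_nonneg c)⟩
  -- Uniform boundedness is used twice: on the dual for fixed `x`, then on `E`.
  refine banach_steinhaus fun x => ?_
  obtain ⟨C, hC⟩ := banach_steinhaus
    (g := fun k => NormedSpace.inclusionInDoubleDual ℂ E (A k x)) (hφ x)
  refine ⟨C, fun k => ?_⟩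
  rw [← (NormedSpace.inclusionInDoubleDualLi ℂ).norm_map (A k x)]
  exact hC k

end Operator

/-! ### Excluding unimodular singularities. -/

/-- If the distance of the weak orbits to the positive half line decays at a common rate and `1` is
not in the spectrum of `S`, then no unimodular number is. -/
theorem ComplexBanachLattice.isUnit_one_sub_smul_of_decreasingRearrangement_le {X E : Type*}
    [NormedAddCommGroup X] [NormedSpace ℝ X] [CompleteSpace X]
    [Lattice X] [IsOrderedAddMonoid X] [IsOrderedModule ℝ X] [HasSolidNorm X]
    [NormedAddCommGroup E] [NormedSpace ℂ E] [CompleteSpace E]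
    (L : ComplexBanachLattice X E) {S : E →L[ℂ] E} (hS : spectralRadius ℂ S ≤ 1)
    (h1 : IsUnit (1 - S)) {f : ℕ → ℝ} (hf : f ∈ c0Pos)
    (H : ∀ x ∈ L.posCone, ∀ φ ∈ L.dualPosCone,
      BddAbove (Set.range fun n : ℕ => distPos (φ ((S ^ n) x))) ∧
        ∃ c : ℝ, 0 ≤ c ∧
          ∀ n, decreasingRearrangement (fun n : ℕ => distPos (φ ((S ^ n) x))) n ≤ c * f n)
    {w : ℂ} (hw : ‖w‖ = 1) : IsUnit (1 - w • S) := by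
  by_contra hwS
  -- At level `k` up to `k` exceptional entries cost `δ k * k * B`; since `k * ε k ≤ 1`, the square
  -- in `δ` makes this at most `ε k * B`. The term `ε k` in `h` absorbs it and allows division where
  -- `f` vanishes.
  let ε : ℕ → ℝ := fun k => 1 / ((k : ℝ) + 2)
  let δ : ℕ → ℝ := fun k => ε k ^ 2
  let s : ℕ → ℝ := fun k => 1 - δ k
  let h : ℕ → ℝ := fun k => f k + ε k
  let U : ℂ → E →L[ℂ] E := fun z => Ring.inverse (1 - z • S)
  let A : ℕ → E →L[ℂ] E := fun k => ((δ k / h k : ℝ) : ℂ) • U (s k * w)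
  have hε0 (k) : 0 < ε k := by positivity
  have hε1 (k) : ε k < 1 := by
    rw [div_lt_one (by positivity)]
    linarith [k.cast_nonneg (α := ℝ)]
  have hkε (k : ℕ) : k * ε k ≤ 1 := by
    rw [mul_one_div, div_le_one (by positivity)]
    linarith
  have hεlim : Tendsto ε atTop (𝓝 0) := by
    have := (tendsto_one_div_add_atTop_nhds_zero_nat (𝕜 := ℝ)).comp (tendsto_add_atTop_nat 1)
    refine this.congr fun k => ?_
    simp only [Function.comp_apply, ε]
    push_cast
    ring
  have hδ0 (k) : 0 < δ k := pow_pos (hε0 k) 2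
  have hδε (k) : δ k ≤ ε k := by
    change ε k ^ 2 ≤ ε k
    rw [sq]
    exact mul_le_of_le_one_left (hε0 k).le (hε1 k).le
  have hεh (k) : ε k ≤ h k := le_add_of_nonneg_left (hf.1 k)
  have hfh (k) : f k ≤ h k := le_add_of_nonneg_right (hε0 k).le
  have hh0 (k) : 0 < h k := (hε0 k).trans_le (hεh k)
  have hs0 (k) : 0 ≤ s k := sub_nonneg.2 ((hδε k).trans (hε1 k).le)
  have hs1 (k) : s k < 1 := sub_lt_self _ (hδ0 k)
  have hns (k) : ‖(s k : ℂ)‖ = s k := by rw [Complex.norm_real, Real.norm_of_nonneg (hs0 k)]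
  have hhlim : Tendsto h atTop (𝓝 0) := by simpa using hf.2.add hεlim
  obtain ⟨M, hM⟩ : ∃ M, ∀ k, ‖U (s k)‖ ≤ M := by
    have hs : Tendsto (fun k => 1 - (s k : ℂ) • S) atTop (𝓝 (1 - S)) := by
      have : Tendsto s atTop (𝓝 1) := by simpa using (hεlim.pow 2).const_sub 1
      have := (Complex.continuous_ofReal.tendsto 1).comp this
      simpa using (this.smul_const S).const_sub 1
    obtain ⟨u, hu⟩ := h1
    have hU := (NormedRing.inverse_continuousAt u).tendsto
    rw [hu] at hU
    obtain ⟨M, hM⟩ := (Metric.isBounded_range_of_tendsto _ (hU.comp hs)).exists_norm_le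
    exact ⟨M, fun k => hM _ ⟨k, rfl⟩⟩
  obtain ⟨C, hC⟩ : ∃ C, ∀ k, ‖A k‖ ≤ C := by
    refine exists_norm_le_of_weakly_bounded L.span_posCone L.span_dualPosCone fun x hx φ hφ => ?_
    obtain ⟨hbdd, c, hc, hle⟩ := H x hx φ hφ
    obtain ⟨B, hB⟩ := id hbdd
    replace hB (n : ℕ) : distPos (φ ((S ^ n) x)) ≤ B := hB ⟨n, rfl⟩
    have hB0 : 0 ≤ B := (distPos_nonneg _).trans (hB 0)
    refine ⟨‖φ‖ * (M * ‖x‖) + 2 * ((c + 1) + B), fun k => ?_⟩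
    obtain ⟨hsum, hAbel⟩ := one_sub_mul_tsum_pow_mul_le (fun n => distPos_nonneg _) hB
      -- The extra `ε k` supplies the strict inequality needed to count entries.
      (t := c * f k + ε k) (add_nonneg (mul_nonneg hc (hf.1 k)) (hε0 k).le)
      (encard_lt_of_decreasingRearrangement_lt hbdd
        ((hle k).trans_lt (lt_add_of_pos_right _ (hε0 k)))) (hs0 k) (hs1 k)
    have hmain := norm_apply_inverse_one_sub_smul_le hS φ x (hs0 k) (hs1 k) hw hsum
    have hUx : ‖φ (U (s k) x)‖ ≤ ‖φ‖ * (M * ‖x‖) :=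
      (φ.le_opNorm _).trans (mul_le_mul_of_nonneg_left ((U (s k)).le_of_opNorm_le (hM k) x)
        (norm_nonneg _))
    have hUx0 : 0 ≤ ‖φ‖ * (M * ‖x‖) := (norm_nonneg _).trans hUx
    have h1s : 1 - s k = δ k := sub_sub_cancel _ _
    rw [h1s] at hAbel
    have hkδ : δ k * (k * B) ≤ h k * B := by
      calc δ k * (k * B) = (k * ε k) * (ε k * B) := by simp only [δ]; ring
        _ ≤ 1 * (h k * B) := by
          gcongr
          · exact hkε k
          · exact hεh k
        _ = _ := one_mul _
    have hcf : c * f k ≤ c * h k := mul_le_mul_of_nonneg_left (hfh k) hc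
    have hδU : δ k * (‖φ‖ * (M * ‖x‖)) ≤ h k * (‖φ‖ * (M * ‖x‖)) :=
      mul_le_mul_of_nonneg_right ((hδε k).trans (hεh k)) hUx0
    have hbound := mul_le_mul_of_nonneg_left (hmain.trans (add_le_add_left hUx _)) (hδ0 k).le
    have hnorm : ‖φ (A k x)‖ = δ k * ‖φ (U (s k * w) x)‖ / h k := by
      simp only [A, smul_apply, map_smul, norm_smul, Complex.norm_real,
        Real.norm_of_nonneg (div_pos (hδ0 k) (hh0 k)).le]
      ring
    rw [hnorm, div_le_iff₀ (hh0 k)]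
    refine hbound.trans ?_
    linarith [hεh k]
  have hlow (k) : 1 ≤ h k * (C * ‖S‖) := by
    have hn : ‖(s k : ℂ) * w‖ < 1 := by rw [norm_mul, hns, hw, mul_one]; exact hs1 k
    have hunit : IsUnit (1 - ((s k : ℂ) * w) • S) := by
      refine spectrum.isUnit_one_sub_smul_of_lt_inv_radius
        (lt_of_lt_of_le ?_ (ENNReal.one_le_inv.2 hS))
      exact_mod_cast hn
    have hdist : ‖w - s k * w‖ = δ k := by
      rw [show w - s k * w = ((δ k : ℝ) : ℂ) * w by simp only [s]; push_cast; ring, norm_mul, hw,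
        mul_one, Complex.norm_real, Real.norm_of_nonneg (hδ0 k).le]
    have hA : ‖A k‖ = δ k * ‖U (s k * w)‖ / h k := by
      simp only [A, norm_smul, Complex.norm_real, Real.norm_of_nonneg (div_pos (hδ0 k) (hh0 k)).le]
      ring
    have hAC := hC k
    rw [hA, div_le_iff₀ (hh0 k)] at hAC
    have h2 := one_le_norm_sub_mul_norm_inverse hunit hwS
    rw [hdist] at h2
    refine h2.trans ((mul_le_mul_of_nonneg_right hAC (norm_nonneg S)).trans_eq ?_)
    ring
  have := ge_of_tendsto' (hhlim.mul_const (C * ‖S‖)) hlow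
  norm_num at this

/-! ### Reduction to one rate, and the conclusion. -/

/-- Countably many positive null sequences are dominated, up to constants, by a single one. -/
theorem exists_c0Pos_forall_le {F : Set (ℕ → ℝ)} (hF : F.Countable) (hF0 : F ⊆ c0Pos) :
    ∃ f ∈ c0Pos, ∀ g ∈ F, ∃ c : ℝ, 0 ≤ c ∧ ∀ n, g n ≤ c * f n := by
  rcases F.eq_empty_or_nonempty with rfl | hne
  · exact ⟨0, ⟨fun _ => le_rfl, tendsto_const_nhds⟩, by simp⟩
  obtain ⟨g, rfl⟩ := hF.exists_eq_range hne
  have hg (k) : g k ∈ c0Pos := hF0 ⟨k, rfl⟩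
  have hb (k) : ∃ B, 0 < B ∧ ∀ n, g k n ≤ B := by
    obtain ⟨B, hB⟩ := (hg k).2.bddAbove_range
    exact ⟨max B 1, by positivity, fun n => (hB ⟨n, rfl⟩).trans (le_max_left _ _)⟩
  choose B hB0 hB using hb
  -- Normalizing by `B k` makes the sum over `k` uniformly dominated by a geometric series, so it is
  -- again a null sequence.
  let a : ℕ → ℕ → ℝ := fun k n => (1 / 2) ^ k * (g k n / B k)
  have ha0 (k n) : 0 ≤ a k n :=
    mul_nonneg (by positivity) (div_nonneg ((hg k).1 n) (hB0 k).le)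
  have ha1 (k n) : a k n ≤ (1 / 2) ^ k :=
    mul_le_of_le_one_right (by positivity) ((div_le_one (hB0 k)).2 (hB k n))
  have hsum (n) : Summable fun k => a k n :=
    Summable.of_nonneg_of_le (ha0 · n) (ha1 · n) summable_geometric_two
  refine ⟨fun n => ∑' k, a k n, ⟨fun n => tsum_nonneg (ha0 · n), ?_⟩, ?_⟩
  · have := tendsto_tsum_of_dominated_convergence (f := fun n k => a k n) (g := fun _ => (0 : ℝ))
      (𝓕 := atTop) summable_geometric_two
      (fun k => by
        have := ((hg k).2.div_const (B k)).const_mul ((1 / 2 : ℝ) ^ k)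
        rwa [zero_div, mul_zero] at this)
      (Eventually.of_forall fun n k => by rw [Real.norm_of_nonneg (ha0 k n)]; exact ha1 k n)
    simpa using this
  · rintro _ ⟨k, rfl⟩
    refine ⟨2 ^ k * B k, mul_nonneg (by positivity) (hB0 k).le, fun n => ?_⟩
    have h1 : a k n ≤ ∑' k, a k n := (hsum n).le_tsum k fun j _ => ha0 j n
    calc g k n = 2 ^ k * B k * a k n := by
          have := (hB0 k).ne'
          simp only [a, one_div, inv_pow]
          field_simp
      _ ≤ _ := mul_le_mul_of_nonneg_left h1 (mul_nonneg (by positivity) (hB0 k).le)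

theorem theorem5p7 {X E : Type*}
    [NormedAddCommGroup X] [NormedSpace ℝ X] [CompleteSpace X]
    [Lattice X] [IsOrderedAddMonoid X] [IsOrderedModule ℝ X] [HasSolidNorm X]
    [NormedAddCommGroup E] [NormedSpace ℂ E] [CompleteSpace E]
    (L : ComplexBanachLattice X E) (T : E →L[ℂ] E) (hT : 0 < specRad T)
    (S : E →L[ℂ] E) (hS : S = ((specRad T : ℝ) : ℂ)⁻¹ • T) :
    (∀ f ∈ c0Pos,
      (∀ x ∈ L.posCone, ∀ φ ∈ L.dualPosCone,
        Governs {f} (fun n : ℕ => ((distPos (φ ((S ^ n) x)) : ℝ) : ℂ))) →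
      ((specRad T : ℝ) : ℂ) ∈ spectrum ℂ T) ∧
    (∀ F : Set (ℕ → ℝ), F.Countable → F ⊆ c0Pos →
      (∀ x ∈ L.posCone, ∀ φ ∈ L.dualPosCone,
        Governs F (fun n : ℕ => ((distPos (φ ((S ^ n) x)) : ℝ) : ℂ))) →
      ((specRad T : ℝ) : ℂ) ∈ spectrum ℂ T) := by
  suffices hmain : ∀ F : Set (ℕ → ℝ), F.Countable → F ⊆ c0Pos →
      (∀ x ∈ L.posCone, ∀ φ ∈ L.dualPosCone,
        Governs F (fun n : ℕ => ((distPos (φ ((S ^ n) x)) : ℝ) : ℂ))) →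
      ((specRad T : ℝ) : ℂ) ∈ spectrum ℂ T from
    ⟨fun f hf => hmain {f} (Set.countable_singleton f) (Set.singleton_subset_iff.2 hf), hmain⟩
  intro F hF hF0 H
  by_contra hr
  -- `toReal` sends `⊤` to `0`, so `hT` rules it out; below, `hT` likewise excludes an empty
  -- spectrum.
  have hfin : spectralRadius ℂ T ≠ ⊤ := fun h => by simp [specRad, h] at hT
  have hr0 : ((specRad T : ℝ) : ℂ) ≠ 0 := Complex.ofReal_ne_zero.2 hT.ne'
  have hresolvent (z : ℂ) (hz : z ≠ 0) : IsUnit (1 - z • S) ↔ z⁻¹ * specRad T ∉ spectrum ℂ T := by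
    rw [spectrum.notMem_iff, Algebra.algebraMap_eq_smul_one,
      ← isUnit_smul_iff (Units.mk0 (z⁻¹ * specRad T) (mul_ne_zero (inv_ne_zero hz) hr0))
        (1 - z • S), hS, Units.smul_mk0, smul_sub, smul_smul, smul_smul,
      show z⁻¹ * (specRad T : ℂ) * z * (specRad T : ℂ)⁻¹ = 1 by field_simp, one_smul]
  have hSrad : spectralRadius ℂ S ≤ 1 := by
    refine iSup₂_le fun μ hμ => ?_
    rcases eq_or_ne μ 0 with rfl | hμ0
    · simp
    have hμT : μ * specRad T ∈ spectrum ℂ T := by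
      by_contra hn
      have hu := (hresolvent μ⁻¹ (inv_ne_zero hμ0)).2 (by rwa [inv_inv])
      rw [← isUnit_smul_iff (Units.mk0 μ hμ0), Units.smul_mk0, smul_sub, smul_smul,
        mul_inv_cancel₀ hμ0, one_smul, ← Algebra.algebraMap_eq_smul_one] at hu
      exact hμ hu
    have h : (‖μ * specRad T‖₊ : ENNReal) ≤ spectralRadius ℂ T :=
      le_iSup₂ (f := fun k (_ : k ∈ spectrum ℂ T) => (‖k‖₊ : ENNReal)) _ hμT
    have h' := ENNReal.toReal_mono hfin h
    change ‖μ * specRad T‖ ≤ specRad T at h'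
    rw [norm_mul, Complex.norm_real, Real.norm_of_nonneg hT.le] at h'
    have : ‖μ‖ ≤ 1 := (mul_le_iff_le_one_left hT).1 h'
    exact_mod_cast this
  obtain ⟨ζ, hζ, hζr⟩ : ∃ ζ ∈ spectrum ℂ T, (‖ζ‖₊ : ENNReal) = spectralRadius ℂ T := by
    refine spectrum.exists_nnnorm_eq_spectralRadius_of_nonempty ?_
    by_contra hne
    rw [Set.not_nonempty_iff_eq_empty] at hne
    simp [specRad, spectralRadius, hne] at hT
  have hζn : ‖ζ‖ = specRad T := by simp [specRad, ← hζr]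
  have hζ0 : ζ ≠ 0 := norm_pos_iff.1 (hζn ▸ hT)
  obtain ⟨f, hf, hFf⟩ := exists_c0Pos_forall_le hF hF0
  have hunit := L.isUnit_one_sub_smul_of_decreasingRearrangement_le hSrad
    (by simpa using (hresolvent 1 one_ne_zero).2 (by simpa using hr)) hf
    (fun x hx φ hφ => by
      obtain ⟨hlim, g, hg, hle⟩ := H x hx φ hφ
      have hnorm (n : ℕ) : ‖((distPos (φ ((S ^ n) x)) : ℝ) : ℂ)‖ = distPos (φ ((S ^ n) x)) := by
        rw [Complex.norm_real, Real.norm_of_nonneg (distPos_nonneg _)]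
      simp only [hnorm] at hle
      obtain ⟨-, c, hc, hcg⟩ := hle
      obtain ⟨c', hc', hgf⟩ := hFf g hg
      refine ⟨?_, c * c', mul_nonneg hc hc', fun n => (hcg n).trans ?_⟩
      · have := hlim.norm.bddAbove_range
        simpa only [hnorm] using this
      · rw [mul_assoc]
        exact mul_le_mul_of_nonneg_left (hgf n) hc)
    -- With this `w`, `w⁻¹ * specRad T = ζ`, the peripheral spectral value.
    (w := specRad T / ζ) (by
      rw [norm_div, hζn, Complex.norm_real, Real.norm_of_nonneg hT.le, div_self hT.ne'])
  rw [hresolvent _ (div_ne_zero hr0 hζ0)] at hunit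
  refine hunit ?_
  rwa [inv_div, div_mul_cancel₀ _ hr0]
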